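/- For $n\ge 1$ let $\mathcal{E}_{2n}$ be the set of permutations $\sigma$ of $[2n]=\{1,\dots,2n\}$ such that $i>\sigma(i)$ implies that $i$ is even and $\sigma(i)$ is odd (E-permutations), and let $\mathcal{X}_{2n}$ be the set of permutations $\sigma=\sigma_1\cdots\sigma_{2n}$ of $[2n]$ such that $\sigma_i>\sigma_{i+1}$ implies that $\sigma_i$ is even and $\sigma_{i+1}$ is odd (even-odd descent permutations). For a permutation $\sigma$ let $\mathrm{des}\,\sigma$ be the number of $i$ with $\sigma_i>\sigma_{i+1}$, $\mathrm{lma}\,\sigma$ the number of left-to-right maxima (indices $i$ with $\sigma_j<\sigma_i$ for all $j<i$), $\mathrm{drop}\,\sigma$ the number of $i$ with $\sigma(i)<i$, and $\mathrm{cyc}\,\sigma$ the number of cycles of $\sigma$ (fixed points included). Then for $n\ge 1$ $$P_n(t,z):=\sum_{\sigma\in\mathcal{X}_{2n}}t^{\mathrm{des}\,\sigma}z^{\mathrm{lma}\,\sigma}=\sum_{\sigma\in\mathcal{E}_{2n}}t^{\mathrm{drop}\,\sigma}z^{\mathrm{cyc}\,\sigma},$$ and, as formal power series in $x$ (the infinite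 continued fraction being the coefficientwise limit of its convergents), $$1+\sum_{n\ge 1}P_n(t,z)x^n=\cfrac{1}{1-b_0x-\cfrac{\lambda_1x^2}{1-b_1x-\cfrac{\lambda_2x^2}{1-b_2x-\cdots}}},$$ where for all $n\ge 0$ $$b_n=(z+n)\bigl(z+n+(n+1)t\bigr),\qquad \lambda_{n+1}=(n+1)(z+n)(z+n+1)^2\,t.$$ -/

import Mathlib

namespace EvenOddPerm

/-- The even-odd descent permutations of `[2n]`. The letter `k` of `[2n]` is the element of
`Fin (2 * n)` with value `k - 1`, and `σ` is read as the word `σ 0, σ 1, …, σ (2n - 1)`.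
Every descent (consecutive letters `σ i > σ j`, `j = i + 1`) has an even top and an odd bottom. -/
def evenOddDescentPerms (n : ℕ) : Finset (Equiv.Perm (Fin (2 * n))) :=
  Finset.univ.filter fun σ => ∀ i j : Fin (2 * n), (i : ℕ) + 1 = (j : ℕ) → σ j < σ i →
    Even ((σ i : ℕ) + 1) ∧ Odd ((σ j : ℕ) + 1)

/-- The E-permutations (even-odd drop permutations) of `[2n]`: if `i > σ(i)`, then `i` is even
and `σ(i)` is odd. The letter `k` of `[2n]` is the element of `Fin (2 * n)` with value `k - 1`. -/
def ePerms (n : ℕ) : Finset (Equiv.Perm (Fin (2 * n))) :=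
  Finset.univ.filter fun σ => ∀ i : Fin (2 * n), σ i < i →
    Even ((i : ℕ) + 1) ∧ Odd ((σ i : ℕ) + 1)

/-- The number of descents of the word `σ 0, σ 1, …, σ (m - 1)`. -/
def des {m : ℕ} (σ : Equiv.Perm (Fin m)) : ℕ :=
  (Finset.univ.filter fun p : Fin m × Fin m =>
    (p.1 : ℕ) + 1 = (p.2 : ℕ) ∧ σ p.2 < σ p.1).card

/-- The number of left-to-right maxima of the word `σ 0, σ 1, …, σ (m - 1)`. -/
def lma {m : ℕ} (σ : Equiv.Perm (Fin m)) : ℕ :=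
  (Finset.univ.filter fun i : Fin m => ∀ j : Fin m, j < i → σ j < σ i).card

/-- The number of drops of `σ`, i.e. of `i` with `σ(i) < i`. -/
def drop {m : ℕ} (σ : Equiv.Perm (Fin m)) : ℕ :=
  (Finset.univ.filter fun i : Fin m => σ i < i).card

/-- The number of cycles of `σ`, fixed points included. -/
def cyc {m : ℕ} (σ : Equiv.Perm (Fin m)) : ℕ :=
  Multiset.card σ.partition.parts

/-- `P_n(t, z) = ∑ t ^ des σ * z ^ lma σ` over the even-odd descent permutations of `[2n]`,
for elements `t`, `z` of a commutative ring (in particular for two indeterminates). -/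
def P {R : Type*} [CommRing R] (n : ℕ) (t z : R) : R :=
  ∑ σ ∈ evenOddDescentPerms n, t ^ des σ * z ^ lma σ

open PowerSeries in
/-- The `m`-th convergent, started at row `i`, of the J-fraction with coefficients `b`, `lam`:
`1 / (1 - b i x - lam i x² / (1 - b (i+1) x - lam (i+1) x² / ⋯ ))`, cut after `m` rows.
So `b i` is the usual `b_i` and `lam i` is the usual `λ_{i+1}`. The inverse is that of a power
series with constant coefficient `1`. -/
noncomputable def jConvergent {R : Type*} [CommRing R] (b lam : ℕ → R) : ℕ → ℕ → PowerSeries R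
  | 0, _ => 0
  | m + 1, i => invOfUnit
      (1 - C (b i) * X - C (lam i) * X ^ 2 * jConvergent b lam m (i + 1)) 1

open PowerSeries in
theorem jConvergent_succ_mul {R : Type*} [CommRing R] (b lam : ℕ → R) (m i : ℕ) :
    (1 - C (b i) * X - C (lam i) * X ^ 2 * jConvergent b lam m (i + 1)) *
      jConvergent b lam (m + 1) i = 1 := by
  rw [jConvergent]
  exact mul_invOfUnit _ _ (by simp)

/-- The formal power series `f` equals the infinite J-fraction
`1 / (1 - b 0 x - lam 0 x² / (1 - b 1 x - lam 1 x² / ⋯ ))`: the convergents tend to `f` as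
formal power series, i.e. each coefficient is eventually constant with the value in `f`. -/
def IsJFraction {R : Type*} [CommRing R] (f : PowerSeries R) (b lam : ℕ → R) : Prop :=
  ∀ k : ℕ, ∀ᶠ m in Filter.atTop,
    PowerSeries.coeff k (jConvergent b lam m 0) = PowerSeries.coeff k f

end EvenOddPerm

/-! Both families are built by inserting letters in decreasing order. A new smallest letter goes to
the front of the word (a new left-to-right maximum) or right after a letter `a`, which becomes the
top of a descent and loses its former bottom, if any. In cycles it becomes a fixed point or follows
`a` in its cycle, with drops in place of descents. The two processes are instances of one
`InsertionScheme`.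

A forbidden even bottom may appear on the way, since a later insertion can replace it. The variable
`X` marks tops that still await an insertion, so inserting after some letter is differentiation by
the product rule, and `X = 0` at the end selects the admissible permutations. Hence both sums are
the constant term of `insertionPoly` (`InsertionScheme.sum_filter_eq`).

Two insertions, of an even and then an odd letter, act on the coefficients by a tridiagonal
recursion, which yields the J-fraction (`isJFraction_of_tridiagonal`). -/

namespace EvenOddPerm

/-! ### J-fractions from tridiagonal recursions. -/

section JFraction

open PowerSeries

variable {R : Type*} [CommRing R]

/-- Solutions of a tridiagonal system of power series have ratios of consecutive entries
approximated by the convergents of a J-fraction. -/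
theorem X_pow_dvd_sub_jConvergent {b u d : ℕ → R} {A : ℕ → PowerSeries R}
    (hA : ∀ k, A (k + 1) =
      X * (C (b (k + 1)) * A (k + 1) + C (d (k + 1)) * A (k + 2) + C (u k) * A k)) (m k : ℕ) :
    X ^ (m + 1) ∣
      A (k + 1) - X * C (u k) * jConvergent b (fun i => u i * d i) m (k + 1) * A k := by
  induction m generalizing k with
  | zero =>
    rw [jConvergent, mul_zero, zero_mul, sub_zero, zero_add, pow_one, hA]
    exact dvd_mul_right _ _
  | succ m ih =>
    obtain ⟨g, hg⟩ := ih (k + 1)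
    have hJ := jConvergent_succ_mul b (fun i => u i * d i) m (k + 1)
    rw [map_mul] at hJ
    -- Solving row `k + 1` for `A (k + 1)` multiplies the error of the row below by `X`, which
    -- raises the order of the error by one.
    refine ⟨jConvergent b (fun i => u i * d i) (m + 1) (k + 1) * C (d (k + 1)) * g, ?_⟩
    linear_combination (-A (k + 1)) * hJ +
      jConvergent b (fun i => u i * d i) (m + 1) (k + 1) * hA k +
      X * C (d (k + 1)) * jConvergent b (fun i => u i * d i) (m + 1) (k + 1) * hg

/-- A doubly indexed sequence satisfying a tridiagonal recursion has a J-fraction as the generating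
function of its zeroth column. -/
theorem isJFraction_of_tridiagonal {b u d : ℕ → R} {c : ℕ → ℕ → R}
    (h0 : c 0 0 = 1) (h0s : ∀ k, c 0 (k + 1) = 0)
    (hz : ∀ n, c (n + 1) 0 = b 0 * c n 0 + d 0 * c n 1)
    (hs : ∀ n k, c (n + 1) (k + 1) =
      b (k + 1) * c n (k + 1) + d (k + 1) * c n (k + 2) + u k * c n k) :
    IsJFraction (PowerSeries.mk fun n => c n 0) b (fun k => u k * d k) := by
  let A : ℕ → PowerSeries R := fun k => PowerSeries.mk fun n => c n k
  have hA0 : A 0 = 1 + X * (C (b 0) * A 0 + C (d 0) * A 1) := by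
    ext n
    cases n with
    | zero => simp [A, h0]
    | succ n => simp [A, hz, coeff_succ_X_mul, coeff_one]
  have hA : ∀ k, A (k + 1) =
      X * (C (b (k + 1)) * A (k + 1) + C (d (k + 1)) * A (k + 2) + C (u k) * A k) := by
    intro k
    ext n
    cases n with
    | zero => simp [A, h0s]
    | succ n => simp [A, hs, coeff_succ_X_mul]
  intro k
  filter_upwards [Filter.eventually_ge_atTop (k + 1)] with m hm
  obtain ⟨m, rfl⟩ : ∃ l, m = l + 1 := ⟨m - 1, by omega⟩
  obtain ⟨g, hg⟩ := X_pow_dvd_sub_jConvergent hA m 0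
  have hJ := jConvergent_succ_mul b (fun i => u i * d i) m 0
  rw [map_mul] at hJ
  have key : X ^ (m + 2) ∣ A 0 - jConvergent b (fun i => u i * d i) (m + 1) 0 := by
    refine ⟨jConvergent b (fun i => u i * d i) (m + 1) 0 * C (d 0) * g, ?_⟩
    rw [zero_add] at hg hJ
    linear_combination (-A 0) * hJ + jConvergent b (fun i => u i * d i) (m + 1) 0 * hA0 +
      X * C (d 0) * jConvergent b (fun i => u i * d i) (m + 1) 0 * hg
  have := X_pow_dvd_iff.mp key k (by omega)
  rw [map_sub, sub_eq_zero] at this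
  exact this.symm

end JFraction

end EvenOddPerm

/-! ### Weighted insertion of smallest letters. -/

namespace EvenOddPerm

open Polynomial

variable {R : Type*} [CommRing R]

/-- The weight of the letter `a` among the top `m` letters of some `[2n]`, so that `a` stands for
an even letter if and only if `a + m + 1` is even, where `b` is the current bottom of the descent
(or drop) with top `a`, if there is one. A top whose bottom still has to be replaced by an odd
letter has the weight `t X`. -/
noncomputable def letterWeight (t : R) (m : ℕ) (a : Fin m) (b : Option (Fin m)) : R[X] :=
  if Even ((a : ℕ) + m + 1) then
    b.elim (1 + C t * X) fun b => if Even ((b : ℕ) + m + 1) then C t * X else C t * (1 + X)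
  else b.elim 1 fun _ => 0

theorem letterWeight_succ (t : R) (m : ℕ) (a : Fin m) (b : Option (Fin m)) :
    letterWeight t (m + 1) a.succ (b.map Fin.succ) = letterWeight t m a b := by
  have h (x : ℕ) : Even (x + 1 + (m + 1) + 1) ↔ Even (x + m + 1) := by grind
  cases b <;> simp [letterWeight, h]

theorem derivative_letterWeight (t : R) (m : ℕ) (a : Fin m) (b : Option (Fin m)) :
    derivative (letterWeight t m a b) = if Even ((a : ℕ) + m + 1) then C t else 0 := by
  cases b with
  | none => by_cases ha : Even ((a : ℕ) + m + 1) <;> simp [letterWeight, ha]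
  | some b =>
    by_cases ha : Even ((a : ℕ) + m + 1) <;> by_cases hb : Even ((b : ℕ) + m + 1) <;>
      simp [letterWeight, ha, hb]

/-- Each weight is affine in `X`, with a slope that ignores the old bottom. Replacing the bottom is
thus differentiation times a factor depending only on the parity of the new letter. -/
theorem letterWeight_some_zero (t : R) (m : ℕ) (a : Fin m) (b : Option (Fin m)) :
    letterWeight t (m + 1) a.succ (some 0) =
      (if Even m then X else 1 + X) * derivative (letterWeight t m a b) := by
  have h (x : ℕ) : Even (x + 1 + (m + 1) + 1) ↔ Even (x + m + 1) := by grind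
  have h' : Even (m + 1 + 1) ↔ Even m := by grind
  rw [derivative_letterWeight, mul_comm]
  by_cases ha : Even ((a : ℕ) + m + 1) <;> by_cases hm : Even m <;>
    simp [letterWeight, h, h', ha, hm]

theorem letterWeight_zero_none (t : R) (m : ℕ) :
    letterWeight t (m + 1) 0 none = if Even m then 1 + C t * X else 1 := by
  have h' : Even (m + 1 + 1) ↔ Even m := by grind
  simp [letterWeight, h']

/-- A way to build the permutations of `m + 1` letters by inserting a smallest letter `0` in the
permutations of `m` letters, either freely or after a letter `a`. The statistic `count` is the
number of free insertions, and `bottom σ a` is the letter inserted last after `a`. -/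
structure InsertionScheme (count : ∀ m, Equiv.Perm (Fin m) → ℕ)
    (bottom : ∀ m, Equiv.Perm (Fin m) → Fin m → Option (Fin m)) where
  insert : ∀ m, Option (Fin m) × Equiv.Perm (Fin m) ≃ Equiv.Perm (Fin (m + 1))
  count_zero : ∀ σ, count 0 σ = 0
  count_insert : ∀ m q τ, count (m + 1) (insert m (q, τ)) = (if q = none then 1 else 0) + count m τ
  bottom_zero : ∀ m σ, bottom (m + 1) σ 0 = none
  bottom_succ : ∀ m q τ a, bottom (m + 1) (insert m (q, τ)) a.succ =
    if q = some a then some 0 else (bottom m τ a).map Fin.succ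

/-- The sum of the weights of all permutations of the top `m` letters. -/
noncomputable def weightSum (t z : R) (count : ∀ m, Equiv.Perm (Fin m) → ℕ)
    (bottom : ∀ m, Equiv.Perm (Fin m) → Fin m → Option (Fin m)) (m : ℕ) : R[X] :=
  ∑ σ : Equiv.Perm (Fin m), C z ^ count m σ * ∏ a, letterWeight t m a (bottom m σ a)

/-- The polynomials that the weight sums of all insertion schemes are equal to. -/
noncomputable def insertionPoly (t z : R) : ℕ → R[X]
  | 0 => 1
  | m + 1 => (if Even m then 1 + C t * X else 1) * (C z * insertionPoly t z m +
      (if Even m then X else 1 + X) * derivative (insertionPoly t z m))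

/-- Insertion after `a` alters only the factor of `a`, so summing over `a` gives the product rule
for the derivative of the total weight. -/
theorem InsertionScheme.weightSum_eq {count : ∀ m, Equiv.Perm (Fin m) → ℕ}
    {bottom : ∀ m, Equiv.Perm (Fin m) → Fin m → Option (Fin m)}
    (S : InsertionScheme count bottom) (t z : R) (m : ℕ) :
    weightSum t z count bottom m = insertionPoly t z m := by
  induction m with
  | zero => simp [weightSum, insertionPoly, S.count_zero]
  | succ m ih =>
    rw [insertionPoly, ← ih, weightSum, ← (S.insert m).sum_comp, Fintype.sum_prod_type_right,
      weightSum, derivative_sum, Finset.mul_sum, Finset.mul_sum, ← Finset.sum_add_distrib,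
      Finset.mul_sum]
    refine Finset.sum_congr rfl fun τ _ => ?_
    rw [Fintype.sum_option, ← C_pow (a := z) (n := count m τ), derivative_C_mul, derivative_prod_finset]
    simp only [Fin.prod_univ_succ, S.count_insert, S.bottom_zero, S.bottom_succ,
      letterWeight_zero_none]
    have h (a : Fin m) : ∏ x, letterWeight t (m + 1) x.succ
          (if some a = some x then some 0 else (bottom m τ x).map Fin.succ) =
        (if Even m then X else 1 + X) *
          ((∏ x ∈ Finset.univ.erase a, letterWeight t m x (bottom m τ x)) *
          derivative (letterWeight t m a (bottom m τ a))) := by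
      rw [← Finset.mul_prod_erase _ _ (Finset.mem_univ a), if_pos rfl,
        letterWeight_some_zero t m a (bottom m τ a), Finset.prod_congr rfl fun x hx => by
          rw [if_neg fun e => Finset.ne_of_mem_erase hx (Option.some_injective _ e).symm,
            letterWeight_succ]]
      ring
    simp only [h, letterWeight_succ, ← Finset.mul_sum, reduceCtorEq, if_true, if_false]
    rw [C_pow]
    ring

/-- At `X = 0` a letter weighs `1` without a bottom, `t` as an even top over an odd bottom, and `0`
otherwise. -/
theorem InsertionScheme.sum_filter_eq {count : ∀ m, Equiv.Perm (Fin m) → ℕ}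
    {bottom : ∀ m, Equiv.Perm (Fin m) → Fin m → Option (Fin m)}
    (S : InsertionScheme count bottom) (t z : R) (n : ℕ) :
    ∑ σ : Equiv.Perm (Fin (2 * n)) with ∀ a b, bottom (2 * n) σ a = some b →
        Even ((a : ℕ) + 1) ∧ Odd ((b : ℕ) + 1),
      t ^ (Finset.univ.filter fun a => (bottom (2 * n) σ a).isSome).card * z ^ count (2 * n) σ =
    (insertionPoly t z (2 * n)).coeff 0 := by
  have h (x : ℕ) : Even (x + 2 * n + 1) ↔ Even (x + 1) := by grind
  rw [← S.weightSum_eq, weightSum, coeff_zero_eq_eval_zero, eval_finsetSum, Finset.sum_filter]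
  refine Finset.sum_congr rfl fun σ _ => ?_
  rw [eval_mul, eval_prod, eval_pow, eval_C]
  split_ifs with hσ
  · rw [mul_comm, Finset.card_filter, ← Finset.prod_pow_eq_pow_sum]
    congr 1
    refine Finset.prod_congr rfl fun a _ => ?_
    cases hb : bottom (2 * n) σ a with
    | none => by_cases ha : Even ((a : ℕ) + 1) <;> simp [letterWeight, h, ha]
    | some b =>
      obtain ⟨h1, h2⟩ := hσ a b hb
      simp [letterWeight, h, h1, Nat.not_even_iff_odd.mpr h2]
  · push Not at hσ
    obtain ⟨a, b, hb, hab⟩ := hσ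
    rw [Finset.prod_eq_zero (Finset.mem_univ a), mul_zero]
    simp only [letterWeight, hb, h, Option.elim_some]
    split_ifs with h1 h2
    · simp
    · exact absurd (Nat.not_even_iff_odd.mp h2) (hab h1)
    · simp

theorem insertionPoly_coeff_zero (t z : R) (k : ℕ) :
    (insertionPoly t z 0).coeff k = if k = 0 then 1 else 0 := by
  rw [insertionPoly, coeff_one]

theorem insertionPoly_two_mul_succ (t z : R) (n : ℕ) :
    insertionPoly t z (2 * (n + 1)) =
      C z * ((1 + C t * X) * (C z * insertionPoly t z (2 * n) +
        X * derivative (insertionPoly t z (2 * n)))) +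
      (1 + X) * derivative ((1 + C t * X) * (C z * insertionPoly t z (2 * n) +
        X * derivative (insertionPoly t z (2 * n)))) := by
  rw [show 2 * (n + 1) = 2 * n + 1 + 1 by ring, insertionPoly, insertionPoly]
  simp

theorem isJFraction_insertionPoly (t z : R) :
    IsJFraction (PowerSeries.mk fun n => (insertionPoly t z (2 * n)).coeff 0)
      (fun n : ℕ => (z + n) * (z + n + (n + 1) * t))
      (fun n : ℕ => (n + 1) * (z + n) * (z + n + 1) ^ 2 * t) := by
  -- The Euler operator makes `z + X d/dX` multiply the `k`-th coefficient by `z + k`.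
  have hX (p : R[X]) (k : ℕ) : (X * derivative p).coeff k = k * p.coeff k := by
    cases k with
    | zero => simp
    | succ k => rw [coeff_X_mul, coeff_derivative]; push_cast; ring
  have key := isJFraction_of_tridiagonal (b := fun n : ℕ => (z + n) * (z + n + (n + 1) * t))
    (u := fun n : ℕ => t * (z + n) * (z + n + 1)) (d := fun n : ℕ => (n + 1) * (z + n + 1))
    (c := fun n k => (insertionPoly t z (2 * n)).coeff k)
    (by simp [insertionPoly_coeff_zero]) (by simp [insertionPoly_coeff_zero])
    (fun n => by
      simp only [insertionPoly_two_mul_succ, coeff_add, coeff_C_mul, add_mul, one_mul, mul_assoc,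
        hX, coeff_derivative, coeff_X_mul, coeff_X_mul_zero]
      push_cast
      ring)
    (fun n k => by
      simp only [insertionPoly_two_mul_succ, coeff_add, coeff_C_mul, add_mul, one_mul, mul_assoc,
        hX, coeff_derivative, coeff_X_mul]
      push_cast
      ring)
  convert key using 2
  ring

end EvenOddPerm

/-! ### Insertion into cycles. -/

namespace EvenOddPerm

open Equiv

/-- Each cycle has exactly one maximum. Maxima suit the insertion of a smallest letter, which
changes none of the old ones. -/
theorem cyc_eq_card_maxima {m : ℕ} (σ : Perm (Fin m)) :
    cyc σ = (Finset.univ.filter fun i => ∀ j, σ.SameCycle i j → j ≤ i).card := by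
  classical
  rw [cyc, Perm.parts_partition, Multiset.card_add, Multiset.card_replicate, Perm.cycleType_def,
    Multiset.card_map, Finset.card_val, ← Finset.card_compl, ← Finset.card_filter_add_card_filter_not
      (s := Finset.univ.filter fun i => ∀ j, σ.SameCycle i j → j ≤ i) (fun i => i ∈ σ.support)]
  congr 1
  · symm
    refine Finset.card_bij (fun i _ => σ.cycleOf i) ?_ ?_ ?_
    · intro i hi
      exact Perm.cycleOf_mem_cycleFactorsFinset_iff.mpr (Finset.mem_filter.mp hi).2
    · intro i hi j hj h
      simp only [Finset.mem_filter, Finset.mem_univ, true_and] at hi hj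
      have hs : σ.SameCycle i j :=
        (Perm.sameCycle_iff_cycleOf_eq_of_mem_support hi.2 hj.2).mpr h
      exact le_antisymm (hj.1 i hs.symm) (hi.1 j hs)
    · intro c hc
      have hne := (Perm.mem_cycleFactorsFinset_iff.mp hc).1.nonempty_support
      have hmem := c.support.max'_mem hne
      have hcy := Perm.cycle_is_cycleOf hmem hc
      refine ⟨c.support.max' hne, ?_, hcy.symm⟩
      have hsup := Perm.mem_cycleFactorsFinset_support_le hc hmem
      refine Finset.mem_filter.mpr ⟨Finset.mem_filter.mpr ⟨Finset.mem_univ _, fun j hj => ?_⟩, hsup⟩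
      refine Finset.le_max' _ _ ?_
      rw [hcy, Perm.mem_support_cycleOf_iff' (Perm.mem_support.mp hsup)]
      exact hj
  · congr 1
    ext i
    simp only [Finset.mem_compl, Finset.mem_filter, Finset.mem_univ, true_and]
    refine ⟨fun h => ⟨fun j hj => ?_, h⟩, fun h => h.2⟩
    rw [Perm.notMem_support] at h
    exact (hj.eq_of_left h).ge

theorem sameCycle_map {α β : Type*} {σ : Perm α} {τ : Perm β} {f : α → β}
    (h : ∀ x, τ.SameCycle (f x) (f (σ x))) {x y : α} (hxy : σ.SameCycle x y) :
    τ.SameCycle (f x) (f y) := by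
  obtain ⟨k, rfl⟩ := hxy
  induction k with
  | zero => exact Perm.SameCycle.refl _ _
  | succ k ih =>
    rw [add_comm, zpow_add, zpow_one]
    exact ih.trans (h _)
  | pred k ih =>
    refine ih.trans (Perm.SameCycle.symm ?_)
    have := h ((σ ^ (-(k : ℤ) - 1)) x)
    rwa [← Perm.mul_apply, ← zpow_one_add, add_sub_cancel] at this

/-- The permutations of `m + 1` letters, with a new letter `0` that is a fixed point or is inserted
after a letter `a` into its cycle. -/
def cycleInsert (m : ℕ) : Option (Fin m) × Perm (Fin m) ≃ Perm (Fin (m + 1)) :=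
  -- `Perm.decomposeFin` prescribes the image of `0`; the inverses on both sides make it prescribe
  -- the preimage instead.
  ((Equiv.prodCongr (finSuccEquiv m).symm (Equiv.inv _)).trans Perm.decomposeFin.symm).trans
    (Equiv.inv _)

theorem cycleInsert_none_zero {m : ℕ} (τ : Perm (Fin m)) : cycleInsert m (none, τ) 0 = 0 := by
  simp [cycleInsert, Equiv.symm_apply_eq]

theorem cycleInsert_none_succ {m : ℕ} (τ : Perm (Fin m)) (x : Fin m) :
    cycleInsert m (none, τ) x.succ = (τ x).succ := by
  simp [cycleInsert, Equiv.symm_apply_eq]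

theorem cycleInsert_some_zero {m : ℕ} (a : Fin m) (τ : Perm (Fin m)) :
    cycleInsert m (some a, τ) 0 = (τ a).succ := by
  simp [cycleInsert, Equiv.symm_apply_eq]

theorem cycleInsert_some_succ {m : ℕ} (a : Fin m) (τ : Perm (Fin m)) (x : Fin m) :
    cycleInsert m (some a, τ) x.succ = if a = x then 0 else (τ x).succ := by
  split_ifs with h
  · simp [cycleInsert, Equiv.symm_apply_eq, h]
  · rw [cycleInsert]
    simp only [Equiv.trans_apply, Equiv.inv_apply, Equiv.prodCongr_apply, Prod.map_apply,
      finSuccEquiv_symm_some, Equiv.symm_apply_eq, Perm.decomposeFin_symm_apply_succ,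
      Perm.coe_inv, Equiv.symm_apply_apply]
    rw [swap_apply_of_ne_of_ne (Fin.succ_ne_zero x) fun e => h (Fin.succ_injective _ e).symm]

theorem sameCycle_cycleInsert_succ {m : ℕ} (q : Option (Fin m)) (τ : Perm (Fin m)) (x y : Fin m) :
    (cycleInsert m (q, τ)).SameCycle x.succ y.succ ↔ τ.SameCycle x y := by
  constructor
  · intro h
    refine sameCycle_map (f := Fin.cases (q.getD x) id) (fun i => ?_) h
    cases q with
    | none =>
      cases i using Fin.cases with
      | zero => simp [cycleInsert_none_zero, Perm.SameCycle.refl]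
      | succ i => simp [cycleInsert_none_succ, Perm.SameCycle.refl]
    | some a =>
      cases i using Fin.cases with
      | zero => simp [cycleInsert_some_zero, Perm.SameCycle.refl]
      | succ i =>
        rw [cycleInsert_some_succ]
        split_ifs with hi
        · simp [hi, Perm.SameCycle.refl]
        · simp [Perm.SameCycle.refl]
  · intro h
    refine sameCycle_map (f := Fin.succ) (fun i => ?_) h
    cases q with
    | none =>
      rw [← cycleInsert_none_succ]
      simp [Perm.SameCycle.refl]
    | some a =>
      by_cases hi : a = i
      · subst hi
        rw [← cycleInsert_some_zero, Perm.sameCycle_apply_right]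
        have : cycleInsert m (some a, τ) a.succ = 0 := by simp [cycleInsert_some_succ]
        rw [← this]
        simp [Perm.SameCycle.refl]
      · have : cycleInsert m (some a, τ) i.succ = (τ i).succ := by simp [cycleInsert_some_succ, hi]
        rw [← this]
        simp [Perm.SameCycle.refl]

theorem cyc_cycleInsert {m : ℕ} (q : Option (Fin m)) (τ : Perm (Fin m)) :
    cyc (cycleInsert m (q, τ)) = (if q = none then 1 else 0) + cyc τ := by
  rw [cyc_eq_card_maxima, cyc_eq_card_maxima, Finset.card_filter, Finset.card_filter,
    Fin.sum_univ_succ]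
  congr 1
  · refine if_congr ?_ rfl rfl
    cases q with
    | none =>
      simp only [iff_true]
      exact fun j hj => (hj.eq_of_left (cycleInsert_none_zero τ)).ge
    | some a =>
      simp only [reduceCtorEq, iff_false, not_forall]
      refine ⟨(τ a).succ, ?_, by simp⟩
      rw [← cycleInsert_some_zero]
      simp [Perm.SameCycle.refl]
  · refine Finset.sum_congr rfl fun i _ => if_congr ?_ rfl rfl
    rw [Fin.forall_fin_succ]
    simp [sameCycle_cycleInsert_succ]

/-- The bottom of the drop with top `a`, if there is one. -/
def dropBottom (m : ℕ) (σ : Perm (Fin m)) (a : Fin m) : Option (Fin m) :=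
  if σ a < a then some (σ a) else none

/-- Inserting a smallest letter into the cycles of a permutation. -/
def cycleScheme : InsertionScheme (fun _ σ => cyc σ) dropBottom where
  insert := cycleInsert
  count_zero σ := by simp [cyc_eq_card_maxima]
  count_insert _ q τ := cyc_cycleInsert q τ
  bottom_zero _ σ := by simp [dropBottom]
  bottom_succ m q τ a := by
    cases q with
    | none => simp [dropBottom, cycleInsert_none_succ, apply_ite (Option.map Fin.succ)]
    | some b =>
      rw [dropBottom, cycleInsert_some_succ]
      by_cases h : b = a <;> simp [h, dropBottom, apply_ite (Option.map Fin.succ)]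

/-! ### Insertion into words. -/

/-- The position at which the letter `0` is inserted into the word `τ`: at the start, or right after
the letter `a`. -/
def insertPos {m : ℕ} (q : Option (Fin m)) (τ : Perm (Fin m)) : Fin (m + 1) :=
  q.elim 0 fun a => (τ.symm a).succ

/-- The word `τ`, its letters increased by one, with the new letter `0` at the start or right after
the letter `a`. -/
def wordInsertPerm {m : ℕ} (q : Option (Fin m)) (τ : Perm (Fin m)) : Perm (Fin (m + 1)) :=
  ((finSuccEquiv' (insertPos q τ)).trans (optionCongr τ)).trans (finSuccEquiv m).symm

theorem wordInsertPerm_insertPos {m : ℕ} (q : Option (Fin m)) (τ : Perm (Fin m)) :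
    wordInsertPerm q τ (insertPos q τ) = 0 := by
  simp [wordInsertPerm]

theorem wordInsertPerm_succAbove {m : ℕ} (q : Option (Fin m)) (τ : Perm (Fin m)) (i : Fin m) :
    wordInsertPerm q τ ((insertPos q τ).succAbove i) = (τ i).succ := by
  simp [wordInsertPerm]

theorem wordInsertPerm_symm_zero {m : ℕ} (q : Option (Fin m)) (τ : Perm (Fin m)) :
    (wordInsertPerm q τ).symm 0 = insertPos q τ := by
  rw [symm_apply_eq, wordInsertPerm_insertPos]

theorem wordInsertPerm_symm_succ {m : ℕ} (q : Option (Fin m)) (τ : Perm (Fin m)) (a : Fin m) :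
    (wordInsertPerm q τ).symm a.succ = (insertPos q τ).succAbove (τ.symm a) := by
  rw [symm_apply_eq, wordInsertPerm_succAbove, apply_symm_apply]

theorem insertPos_left_injective {m : ℕ} (τ : Perm (Fin m)) :
    Function.Injective fun q => insertPos q τ := by
  intro q q' h
  match q, q', h with
  | none, none, _ => rfl
  | none, some _, h => exact absurd h.symm (Fin.succ_ne_zero _)
  | some _, none, h => exact absurd h (Fin.succ_ne_zero _)
  | some _, some _, h => exact congrArg some (τ.symm.injective (Fin.succ_injective _ h))

theorem wordInsertPerm_injective (m : ℕ) :
    Function.Injective fun p : Option (Fin m) × Perm (Fin m) => wordInsertPerm p.1 p.2 := by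
  rintro ⟨q, τ⟩ ⟨q', τ'⟩ h
  dsimp only at h
  have hp : insertPos q τ = insertPos q' τ' := by
    rw [← wordInsertPerm_symm_zero, h, wordInsertPerm_symm_zero]
  obtain rfl : τ = τ' := by
    ext1 i
    have := wordInsertPerm_succAbove q τ i
    rw [h, hp, wordInsertPerm_succAbove] at this
    exact (Fin.succ_injective _ this).symm
  rw [insertPos_left_injective τ hp]

/-- The words on `m + 1` letters, with the letter `0` at the start or right after a letter `a`. -/
noncomputable def wordInsert (m : ℕ) : Option (Fin m) × Perm (Fin m) ≃ Perm (Fin (m + 1)) :=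
  Equiv.ofBijective (fun p => wordInsertPerm p.1 p.2) <|
    (Fintype.bijective_iff_injective_and_card _).mpr ⟨wordInsertPerm_injective m, by
      simp [Fintype.card_perm, Nat.factorial_succ]⟩

/-- The letter `0` is a left-to-right maximum only at the front, and it never prevents a larger
letter from being one. -/
theorem lma_wordInsertPerm {m : ℕ} (q : Option (Fin m)) (τ : Perm (Fin m)) :
    lma (wordInsertPerm q τ) = (if q = none then 1 else 0) + lma τ := by
  rw [lma, lma, Finset.card_filter, Finset.card_filter, Fin.sum_univ_succAbove _ (insertPos q τ)]
  congr 1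
  · refine if_congr ?_ rfl rfl
    simp only [wordInsertPerm_insertPos, Fin.not_lt_zero, imp_false, not_lt]
    cases q with
    | none => simp [insertPos]
    | some a =>
      simp only [insertPos, Option.elim_some, reduceCtorEq, iff_false, not_forall]
      exact ⟨0, by simp⟩
  · refine Finset.sum_congr rfl fun i _ => if_congr ?_ rfl rfl
    rw [Fin.forall_iff_succAbove (insertPos q τ)]
    simp [wordInsertPerm_succAbove, wordInsertPerm_insertPos]

/-- The bottom of the descent with top `a`, if there is one. -/
def desBottom (m : ℕ) (σ : Perm (Fin m)) (a : Fin m) : Option (Fin m) :=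
  if h : (σ.symm a : ℕ) + 1 < m then
    if σ ⟨σ.symm a + 1, h⟩ < a then some (σ ⟨σ.symm a + 1, h⟩) else none
  else none

theorem desBottom_eq_some {m : ℕ} {σ : Perm (Fin m)} {a b : Fin m} :
    desBottom m σ a = some b ↔ (σ.symm a : ℕ) + 1 = σ.symm b ∧ b < a := by
  rw [desBottom]
  split_ifs with h h'
  · rw [Option.some_inj, ← σ.eq_symm_apply, Fin.ext_iff]
    refine ⟨fun e => ⟨e, ?_⟩, fun e => e.1⟩
    rwa [σ.eq_symm_apply.mp (Fin.ext e)] at h'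
  · simp only [false_iff, not_and]
    intro e
    rwa [σ.eq_symm_apply.mp (Fin.ext e)] at h'
  · simp only [false_iff, not_and]
    omega

/-- Inserting a smallest letter into a word. -/
noncomputable def wordScheme : InsertionScheme (fun _ σ => lma σ) desBottom where
  insert := wordInsert
  count_zero σ := by simp [lma]
  count_insert _ q τ := lma_wordInsertPerm q τ
  bottom_zero m σ := by
    rw [Option.eq_none_iff_forall_not_mem]
    intro b hb
    exact absurd (desBottom_eq_some.mp hb).2 (Fin.not_lt_zero b)
  bottom_succ m q τ a := by
    change desBottom (m + 1) (wordInsertPerm q τ) a.succ = _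
    have hq : q = some a ↔ insertPos q τ = (τ.symm a).succ :=
      (insertPos_left_injective τ).eq_iff (b := some a).symm
    rw [if_congr hq rfl rfl]
    ext b
    rw [desBottom_eq_some, wordInsertPerm_symm_succ]
    cases b using Fin.cases with
    | zero =>
      rw [wordInsertPerm_symm_zero]
      simp only [Fin.succAbove, Fin.lt_def, Fin.ext_iff, Fin.val_castSucc, Fin.val_succ]
      split_ifs with h1 h2 h2 <;> simp <;> omega
    | succ b =>
      rw [wordInsertPerm_symm_succ, Fin.succ_lt_succ_iff]
      have hb : (desBottom m τ a).map Fin.succ = some b.succ ↔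
          (τ.symm a : ℕ) + 1 = τ.symm b ∧ b < a := by
        rw [← desBottom_eq_some, ← Option.map_some, (Option.map_injective
          (Fin.succ_injective m)).eq_iff]
      -- If `0` directly follows `a`, then `b.succ` cannot. Otherwise `0` does not separate `a` from
      -- its successor, so adjacency is unchanged.
      split_ifs with h
      · simp only [Option.some_inj, (Fin.succ_ne_zero b).symm, iff_false, not_and]
        intro e
        exfalso
        revert e
        simp only [h, Fin.succAbove, Fin.lt_def, Fin.val_castSucc, Fin.val_succ]
        split_ifs <;> simp <;> omega
      · rw [hb]
        refine and_congr_left fun _ => ?_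
        rw [Fin.ext_iff] at h
        simp only [Fin.succAbove, Fin.lt_def, Fin.val_castSucc, Fin.val_succ] at h ⊢
        split_ifs <;> simp <;> omega

/-! ### Both sums as constant terms. -/

theorem P_eq_coeff_insertionPoly {R : Type*} [CommRing R] (n : ℕ) (t z : R) :
    P n t z = (insertionPoly t z (2 * n)).coeff 0 := by
  rw [← wordScheme.sum_filter_eq, P, evenOddDescentPerms]
  refine Finset.sum_congr (Finset.filter_congr fun σ _ => ?_) fun σ _ => ?_
  · simp only [desBottom_eq_some]
    constructor
    · intro h a b hab
      simpa using h _ _ hab.1 (by simpa using hab.2)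
    · intro h i j hij hlt
      exact h _ _ (by simpa using ⟨hij, hlt⟩)
  · congr 2
    -- Descents are matched with their tops: positions on one side, letters on the other.
    refine Finset.card_bij (fun p _ => σ p.1) ?_ ?_ ?_
    · rintro ⟨i, j⟩ hij
      rw [Finset.mem_filter] at hij ⊢
      refine ⟨Finset.mem_univ _, Option.isSome_iff_exists.mpr ⟨σ j, ?_⟩⟩
      simpa [desBottom_eq_some] using hij.2
    · rintro ⟨i, j⟩ hij ⟨i', j'⟩ hij' h
      simp only [Finset.mem_filter, Finset.mem_univ, true_and] at hij hij'
      obtain rfl := σ.injective h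
      rw [Prod.mk.injEq]
      exact ⟨rfl, Fin.ext (hij.1.symm.trans hij'.1)⟩
    · intro a ha
      obtain ⟨b, hb⟩ := Option.isSome_iff_exists.mp (Finset.mem_filter.mp ha).2
      rw [desBottom_eq_some] at hb
      exact ⟨(σ.symm a, σ.symm b), by simpa using hb, by simp⟩

theorem sum_ePerms_eq_coeff_insertionPoly {R : Type*} [CommRing R] (n : ℕ) (t z : R) :
    ∑ σ ∈ ePerms n, t ^ drop σ * z ^ cyc σ = (insertionPoly t z (2 * n)).coeff 0 := by
  rw [← cycleScheme.sum_filter_eq, ePerms]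
  refine Finset.sum_congr (Finset.filter_congr fun σ _ => ?_) fun σ _ => ?_
  · simp [dropBottom]
  · congr 2
    rw [drop]
    congr 1
    ext a
    simp [dropBottom, apply_ite Option.isSome]

end EvenOddPerm

theorem mainTheorem8 {R : Type*} [CommRing R] (t z : R) :
    (∀ n : ℕ, EvenOddPerm.P n t z =
      ∑ σ ∈ EvenOddPerm.ePerms n, t ^ EvenOddPerm.drop σ * z ^ EvenOddPerm.cyc σ) ∧
    EvenOddPerm.IsJFraction
      (PowerSeries.mk fun n : ℕ => if n = 0 then 1 else EvenOddPerm.P n t z)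
      (fun n : ℕ => (z + n) * (z + n + (n + 1) * t))
      (fun n : ℕ => (n + 1) * (z + n) * (z + n + 1) ^ 2 * t) := by
  refine ⟨fun n => ?_, ?_⟩
  · rw [EvenOddPerm.P_eq_coeff_insertionPoly, EvenOddPerm.sum_ePerms_eq_coeff_insertionPoly]
  · convert EvenOddPerm.isJFraction_insertionPoly t z using 3 with n
    split_ifs with h
    · simp [h, EvenOddPerm.insertionPoly_coeff_zero]
    · rw [EvenOddPerm.P_eq_coeff_insertionPoly]
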